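/- Let $n \ge 1$ and consider the $n+1$ nodes $0,1,\dots,n$, with node $i$ placed at the point $(i,0) \in \mathbb{R}^2$. An arc $\gamma$ is given by two nodes $\ell(\gamma) < r(\gamma)$, its left and right endpoints, and a continuous function $\gamma\colon [\ell(\gamma), r(\gamma)] \to \mathbb{R}$ with $\gamma(\ell(\gamma)) = \gamma(r(\gamma)) = 0$ and $\gamma(k) \ne 0$ for every integer $k$ with $\ell(\gamma) < k < r(\gamma)$; it passes above (below) such a node $k$ if $\gamma(k) > 0$ (if $\gamma(k) < 0$). Two arcs are equivalent if they have the same endpoints and pass above the same nodes and below the same nodes; $\mathrm{arc}(n)$ is the set of equivalence classes, and the members of a class are its representatives. Two arcs $\gamma, \rho$ intersect at $x \in \mathbb{R}$ if $x \in [\ell(\gamma),r(\gamma)] \cap [\ell(\rho),r(\rho)]$ and $\gamma(x) = \rho(x)$. A shared endpoint is a point that is the left endpoint of both arcs or the right endpoint of both arcs. Let $\gamma,\rho \in \mathrm{arc}(n)$ share exactly one endpoint and have representatives that do not otherwise intersect. Then $\rho$ is *clockwise* of $\gamma$ if one of the following holds: * $\ell(\gamma)=\ell(\rho)$, and either $r(\gamma)<r(\rho)$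 and $\rho$ passes below $r(\gamma)$, or $r(\rho)<r(\gamma)$ and $\gamma$ passes above $r(\rho)$; * $r(\gamma)=r(\rho)$, and either $\ell(\gamma)<\ell(\rho)$ and $\gamma$ passes below $\ell(\rho)$, or $\ell(\rho)<\ell(\gamma)$ and $\rho$ passes above $\ell(\gamma)$. (That is, $\rho$ lies below $\gamma$ next to a shared left endpoint, or above $\gamma$ next to a shared right endpoint.) A *clockwise-ordered arc diagram* of length $k$ is a sequence $\omega = (\gamma_k,\dots,\gamma_1)$ in $\mathrm{arc}(n)$ such that for all $1 \le i<j \le k$: (1) there are representatives of $\gamma_i$ and $\gamma_j$ that have at most one shared endpoint and do not otherwise intersect; (2) if $\gamma_i$ and $\gamma_j$ have a shared endpoint, then $\gamma_j$ is clockwise of $\gamma_i$. Let $G(\omega)$ be the graph on the vertices $0,\dots,n$ with an edge between $\ell(\gamma_i)$ and $r(\gamma_i)$ for each $i$. Then: 1. For every clockwise-ordered arc diagram $\omega$ of length $k$, there are representatives of $\gamma_1,\dots,\gamma_k$, fixed simultaneously, any two of which have at most one shared endpoint and do not otherwise intersect. The graph $G(\omega)$ is simple with exactly $k$ edges, bipartite,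 and planar. 2. The maximum length of a clockwise-ordered arc diagram on $n+1$ nodes is exactly $\max\{1, 2n-2\}$. 3. If $n \ge 2$, there is a clockwise-ordered arc diagram $\omega$ of length $2n-2$ with $G(\omega)$ isomorphic to the complete bipartite graph $K_{n-1,2}$. -/

import Mathlib

namespace ArcDiagram

/-- An arc on the `n + 1` nodes `0, …, n`, node `i` being the point `(i, 0)` of the plane: two nodes
`left < right` and a continuous function on `[left, right]` that vanishes at both ends and at no node
strictly in between. The values of `toFun` outside `[left, right]` carry no information. -/
structure Curve (n : ℕ) where
  left : ℕ
  right : ℕ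
  left_lt_right : left < right
  right_le : right ≤ n
  toFun : ℝ → ℝ
  continuousOn : ContinuousOn toFun (Set.Icc (left : ℝ) (right : ℝ))
  map_left : toFun left = 0
  map_right : toFun right = 0
  map_ne_zero : ∀ k : ℕ, left < k → k < right → toFun k ≠ 0

namespace Curve

variable {n : ℕ}

/-- The letter at the node `i`: `-1` (written u) if the curve is below the node, `1` (written o) if
it is above the node, `0` (written e) if it goes through the node. -/
noncomputable def letter (γ : Curve n) (i : ℕ) : SignType := SignType.sign (γ.toFun i)

/-- The left endpoint together with the word of the letters at the nodes `left + 1, …, right`. -/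
noncomputable def wd (γ : Curve n) : ℕ × List SignType :=
  (γ.left, (List.range' (γ.left + 1) (γ.right - γ.left)).map γ.letter)

/-- Combinatorial equivalence. -/
instance setoid (n : ℕ) : Setoid (Curve n) where
  r γ ρ := γ.wd = ρ.wd
  iseqv := ⟨fun _ => rfl, fun h => h.symm, fun h₁ h₂ => h₁.trans h₂⟩

/-- The curves `γ` and `ρ` have at most one shared (left or right) endpoint, and do not otherwise
intersect. In particular the right endpoint of one is not the left endpoint of the other. -/
def MeetAtMostOnce (γ ρ : Curve n) : Prop :=
  ¬ (γ.left = ρ.left ∧ γ.right = ρ.right) ∧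
  ∀ x : ℝ, x ∈ Set.Icc (γ.left : ℝ) γ.right → x ∈ Set.Icc (ρ.left : ℝ) ρ.right →
    γ.toFun x = ρ.toFun x →
      (x = γ.left ∧ x = ρ.left) ∨ (x = γ.right ∧ x = ρ.right)

theorem left_eq {γ ρ : Curve n} (h : γ ≈ ρ) : γ.left = ρ.left := congrArg Prod.fst h

theorem right_eq {γ ρ : Curve n} (h : γ ≈ ρ) : γ.right = ρ.right := by
  have h₁ := left_eq h
  have h₂ : γ.wd.2.length = ρ.wd.2.length := congrArg (fun p => p.2.length) h
  simp only [wd, List.length_map, List.length_range'] at h₂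
  have h₃ := γ.left_lt_right
  have h₄ := ρ.left_lt_right
  omega

theorem letter_eq {γ ρ : Curve n} (h : γ ≈ ρ) {k : ℕ} (h₁ : γ.left < k) (h₂ : k < γ.right) :
    γ.letter k = ρ.letter k := by
  have h₃ : γ.wd.2 = ρ.wd.2 := congrArg Prod.snd h
  simp only [wd, ← left_eq h, ← right_eq h] at h₃
  exact List.map_inj_left.1 h₃ k (by rw [List.mem_range'_1]; omega)

/-- The curve passes above the node `k`, which lies strictly between its endpoints. -/
def PassesAbove (γ : Curve n) (k : ℕ) : Prop :=
  γ.left < k ∧ k < γ.right ∧ γ.letter k = 1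

/-- The curve passes below the node `k`, which lies strictly between its endpoints. -/
def PassesBelow (γ : Curve n) (k : ℕ) : Prop :=
  γ.left < k ∧ k < γ.right ∧ γ.letter k = -1

theorem passesAbove_congr {γ ρ : Curve n} (h : γ ≈ ρ) (k : ℕ) :
    γ.PassesAbove k = ρ.PassesAbove k := by
  unfold PassesAbove
  rw [← left_eq h, ← right_eq h]
  exact propext ⟨fun ⟨a, b, c⟩ => ⟨a, b, letter_eq h a b ▸ c⟩,
    fun ⟨a, b, c⟩ => ⟨a, b, (letter_eq h a b).symm ▸ c⟩⟩

theorem passesBelow_congr {γ ρ : Curve n} (h : γ ≈ ρ) (k : ℕ) :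
    γ.PassesBelow k = ρ.PassesBelow k := by
  unfold PassesBelow
  rw [← left_eq h, ← right_eq h]
  exact propext ⟨fun ⟨a, b, c⟩ => ⟨a, b, letter_eq h a b ▸ c⟩,
    fun ⟨a, b, c⟩ => ⟨a, b, (letter_eq h a b).symm ▸ c⟩⟩

end Curve

/-- The set `arc(n)` of arcs on `n + 1` nodes up to combinatorial equivalence. -/
def Arc (n : ℕ) : Type := Quotient (Curve.setoid n)

namespace Arc

variable {n : ℕ}

/-- The curve `γ` is a representative of the arc `a`. -/
def IsRep (γ : Curve n) (a : Arc n) : Prop := Quotient.mk (Curve.setoid n) γ = a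

/-- The left endpoint. -/
def left (a : Arc n) : ℕ := Quotient.lift Curve.left (fun _ _ h => Curve.left_eq h) a

/-- The right endpoint. -/
def right (a : Arc n) : ℕ := Quotient.lift Curve.right (fun _ _ h => Curve.right_eq h) a

/-- The arc `a` passes above the node `k`. -/
def PassesAbove (a : Arc n) (k : ℕ) : Prop :=
  Quotient.lift (fun γ : Curve n => γ.PassesAbove k)
    (fun _ _ h => Curve.passesAbove_congr h k) a

/-- The arc `a` passes below the node `k`. -/
def PassesBelow (a : Arc n) (k : ℕ) : Prop :=
  Quotient.lift (fun γ : Curve n => γ.PassesBelow k)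
    (fun _ _ h => Curve.passesBelow_congr h k) a

theorem left_lt_right (a : Arc n) : a.left < a.right :=
  Quotient.inductionOn a fun γ => γ.left_lt_right

/-- For arcs `a`, `b` that share exactly one endpoint and do not otherwise intersect: `b` is
clockwise of `a`. That is, `b` leaves a shared left endpoint below `a`, or arrives at a shared right
endpoint above `a`. As the arcs do not cross, this is read off at the endpoint of one of them
that lies strictly between the endpoints of the other. -/
def IsClockwiseOf (b a : Arc n) : Prop :=
  (a.left = b.left ∧
    ((a.right < b.right ∧ b.PassesBelow a.right) ∨
     (b.right < a.right ∧ a.PassesAbove b.right))) ∨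
  (a.right = b.right ∧
    ((a.left < b.left ∧ a.PassesBelow b.left) ∨
     (b.left < a.left ∧ b.PassesAbove a.left)))

end Arc

variable {n k : ℕ}

/-- `(ω (k - 1), …, ω 1, ω 0)` is a clockwise-ordered arc diagram of length `k`. -/
structure IsClockwiseOrdered (ω : Fin k → Arc n) : Prop where
  meetAtMostOnce : ∀ i j : Fin k, i < j →
    ∃ γ ρ : Curve n, Arc.IsRep γ (ω i) ∧ Arc.IsRep ρ (ω j) ∧ γ.MeetAtMostOnce ρ
  clockwise : ∀ i j : Fin k, i < j →
    ((ω i).left = (ω j).left ∨ (ω i).right = (ω j).right) → (ω j).IsClockwiseOf (ω i)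

/-- The graph on the nodes `0, …, n` whose edges join the two endpoints of each of the arcs. -/
def graph (ω : Fin k → Arc n) : SimpleGraph (Fin (n + 1)) where
  Adj p q := ∃ i, ((ω i).left = p ∧ (ω i).right = q) ∨ ((ω i).left = q ∧ (ω i).right = p)
  symm := ⟨fun _ _ ⟨i, h⟩ => ⟨i, h.symm⟩⟩
  loopless := ⟨fun p ⟨i, h⟩ => by have := (ω i).left_lt_right; omega⟩

/-- A graph is planar if it can be drawn in the plane: the vertices are distinct points, each edge
is a simple (injective continuous) path between its two ends, whose interior contains no vertex, and
the interiors of the paths of distinct edges are disjoint. -/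
def IsPlanar {V : Type*} (G : SimpleGraph V) : Prop :=
  ∃ (pt : V → ℝ × ℝ) (path : G.edgeSet → unitInterval → ℝ × ℝ),
    Function.Injective pt ∧
    (∀ e, Continuous (path e) ∧ Function.Injective (path e)) ∧
    (∀ e : G.edgeSet, ∃ v w, (e : Sym2 V) = s(v, w) ∧ path e 0 = pt v ∧ path e 1 = pt w) ∧
    (∀ e, ∀ t ∈ Set.Ioo (0 : unitInterval) 1, path e t ∉ Set.range pt) ∧
    (∀ e f, e ≠ f → Disjoint (path e '' Set.Ioo 0 1) (path f '' Set.Ioo 0 1))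

end ArcDiagram

/-!
Non-crossing arcs are comparable: by the intermediate value theorem, one of two such arcs lies below
the other over their common interval, so its letters over the common nodes are at most those of the
other (`Arc.IsBelow`, `Curve.MeetAtMostOnce.noncrossing`). Three arcs over a common interval cannot
lie cyclically below one another (`Arc.IsBelow.endpoints_eq_of_cycle`), since their letters
would agree at both ends of the common interval, where one of them is `0`, and so all three would have
the same endpoints.

Hence the arcs that pass a given node are linearly ordered. Stacking them at each node in
this order and interpolating linearly gives simultaneous representatives
(`stackedCurve_meetAtMostOnce`), which are a plane drawing of the graph. No node is both a left and
a right endpoint, so the graph is bipartite; distinct arcs have distinct pairs of endpoints.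

For the bound `2 * n - 2`, the number of arcs is compared with the number `2 * (n + 1)` of slots, two
for each node. The topmost arc at a left endpoint takes a slot there. Any other arc, together
with the next one above it at the same left endpoint, bounds a wedge; it takes a slot at the first
node to the right that lies in the closed wedge, according to whether the arc ends there or passes
below it. No arc enters a wedge before that node (`IsWedge.not_between`), so no slot is
taken twice (`IsClockwiseOrdered.isSlot_unique`). One slot at the node `0` and both at `n` stay free,
and so does one at some inner node that no arc passes above, or no arc passes below
(`IsClockwiseOrdered.exists_exposed`). Parabolas from the nodes `0` and `1` to all later nodes attain
the bound (`isClockwiseOrdered_fan`) and give `K_{n-1,2}`.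
-/

namespace ArcDiagram

/-! ### Arcs as words, and the vertical order -/

namespace Arc

variable {n : ℕ}

/-- The letter of an arc at the node `k`: `1` if the arc passes above `k`, `-1` if it passes below
`k`, and `0` if `k` is not strictly between the endpoints. -/
noncomputable def letter (a : Arc n) (k : ℕ) : SignType :=
  Quotient.lift (fun γ : Curve n => if γ.left < k ∧ k < γ.right then γ.letter k else 0)
    (fun γ ρ h => by
      rw [← Curve.left_eq h, ← Curve.right_eq h]
      split_ifs with hk
      · exact Curve.letter_eq h hk.1 hk.2
      · rfl) a

theorem right_le (a : Arc n) : a.right ≤ n := Quotient.inductionOn a fun γ => γ.right_le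

theorem letter_ne_zero_iff (a : Arc n) (k : ℕ) :
    a.letter k ≠ 0 ↔ a.left < k ∧ k < a.right := by
  refine Quotient.inductionOn a fun γ => ?_
  change (if γ.left < k ∧ k < γ.right then γ.letter k else 0) ≠ 0 ↔ γ.left < k ∧ k < γ.right
  split_ifs with h
  · refine ⟨fun _ => h, fun _ => ?_⟩
    rw [Curve.letter, ne_eq, sign_eq_zero_iff]
    exact γ.map_ne_zero k h.1 h.2
  · simp [h]

theorem letter_left (a : Arc n) : a.letter a.left = 0 := by
  by_contra h
  have := (a.letter_ne_zero_iff _).1 h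
  omega

theorem letter_right (a : Arc n) : a.letter a.right = 0 := by
  by_contra h
  have := (a.letter_ne_zero_iff _).1 h
  omega

theorem eq_left_or_right_of_letter_eq_zero {a : Arc n} {k : ℕ} (h : a.letter k = 0)
    (h₁ : a.left ≤ k) (h₂ : k ≤ a.right) : k = a.left ∨ k = a.right := by
  by_contra hk
  exact (a.letter_ne_zero_iff k).2 (by omega) h

theorem passesAbove_iff (a : Arc n) (k : ℕ) : a.PassesAbove k ↔ a.letter k = 1 := by
  refine Quotient.inductionOn a fun γ => ?_
  change (γ.left < k ∧ k < γ.right ∧ γ.letter k = 1) ↔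
    (if γ.left < k ∧ k < γ.right then γ.letter k else 0) = 1
  split_ifs with h
  · simp [h]
  · exact ⟨fun h' => absurd ⟨h'.1, h'.2.1⟩ h, fun h' => by simp at h'⟩

theorem passesBelow_iff (a : Arc n) (k : ℕ) : a.PassesBelow k ↔ a.letter k = -1 := by
  refine Quotient.inductionOn a fun γ => ?_
  change (γ.left < k ∧ k < γ.right ∧ γ.letter k = -1) ↔
    (if γ.left < k ∧ k < γ.right then γ.letter k else 0) = -1
  split_ifs with h
  · simp [h]
  · exact ⟨fun h' => absurd ⟨h'.1, h'.2.1⟩ h, fun h' => absurd h' (by decide)⟩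

theorem IsRep.left_eq {γ : Curve n} {a : Arc n} (h : IsRep γ a) : γ.left = a.left := by
  subst h; rfl

theorem IsRep.right_eq {γ : Curve n} {a : Arc n} (h : IsRep γ a) : γ.right = a.right := by
  subst h; rfl

theorem IsRep.letter_eq {γ : Curve n} {a : Arc n} (h : IsRep γ a) {k : ℕ} (h₁ : a.left ≤ k)
    (h₂ : k ≤ a.right) : γ.letter k = a.letter k := by
  subst h
  change γ.left ≤ k at h₁
  change k ≤ γ.right at h₂
  change γ.letter k = if γ.left < k ∧ k < γ.right then γ.letter k else 0
  split_ifs with h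
  · rfl
  · obtain rfl | rfl : k = γ.left ∨ k = γ.right := by omega
    · simp [Curve.letter, γ.map_left]
    · simp [Curve.letter, γ.map_right]

theorem isRep_of_letter_eq {γ : Curve n} {a : Arc n} (hl : γ.left = a.left)
    (hr : γ.right = a.right) (h : ∀ k, a.left ≤ k → k ≤ a.right → γ.letter k = a.letter k) :
    IsRep γ a := by
  obtain ⟨ρ, rfl⟩ := Quotient.exists_rep a
  refine Quotient.sound (show γ.wd = ρ.wd from ?_)
  have hρ : IsRep ρ (Quotient.mk (Curve.setoid n) ρ) := rfl
  rw [← hρ.left_eq] at hl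
  rw [← hρ.right_eq] at hr
  unfold Curve.wd
  rw [hl, hr]
  congr 1
  refine List.map_congr_left fun k hk => ?_
  rw [List.mem_range'_1] at hk
  have h₁ : ρ.left ≤ k := by omega
  have h₂ : k ≤ ρ.right := by omega
  rw [h k h₁ h₂, hρ.letter_eq h₁ h₂]

/-- The arc `a` lies (weakly) below the arc `b`: the intervals that they span overlap in more than a
point, and over every common node `a` has at most the letter of `b`. Comparing the letters, the ends
of the common interval included, suffices to tell which of two non-crossing arcs is the lower one. -/
def IsBelow (a b : Arc n) : Prop :=
  a.left < b.right ∧ b.left < a.right ∧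
    ∀ k, a.left ≤ k → b.left ≤ k → k ≤ a.right → k ≤ b.right → a.letter k ≤ b.letter k

/-- The combinatorial form of "having representatives with at most one shared endpoint that do not
otherwise intersect". -/
structure Noncrossing (a b : Arc n) : Prop where
  endpoints_ne : ¬ (a.left = b.left ∧ a.right = b.right)
  right_ne_left : a.right ≠ b.left
  left_ne_right : a.left ≠ b.right
  isBelow_or_isBelow : a.left < b.right → b.left < a.right → a.IsBelow b ∨ b.IsBelow a

theorem Noncrossing.symm {a b : Arc n} (h : a.Noncrossing b) : b.Noncrossing a where
  endpoints_ne := fun h' => h.endpoints_ne ⟨h'.1.symm, h'.2.symm⟩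
  right_ne_left := h.left_ne_right.symm
  left_ne_right := h.right_ne_left.symm
  isBelow_or_isBelow := fun h₁ h₂ => (h.isBelow_or_isBelow h₂ h₁).symm

theorem IsBelow.refl (a : Arc n) : a.IsBelow a :=
  ⟨a.left_lt_right, a.left_lt_right, fun _ _ _ _ _ => le_rfl⟩

/-- Three arcs over a common interval that lie cyclically below one another have the same
endpoints: their letters agree at both ends of the common interval, where one of them is `0`. -/
theorem IsBelow.endpoints_eq_of_cycle {a b c : Arc n} (hab : a.IsBelow b) (hbc : b.IsBelow c)
    (hca : c.IsBelow a) : a.left = b.left ∧ a.right = b.right := by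
  obtain ⟨h₁, h₂, hab⟩ := hab
  obtain ⟨h₃, h₄, hbc⟩ := hbc
  obtain ⟨h₅, h₆, hca⟩ := hca
  have ha := a.left_lt_right
  have hb := b.left_lt_right
  have hc := c.left_lt_right
  have key : ∀ k, a.left ≤ k → b.left ≤ k → c.left ≤ k → k ≤ a.right → k ≤ b.right →
      k ≤ c.right → (a.letter k = 0 ∨ b.letter k = 0 ∨ c.letter k = 0) →
      (k = a.left ∨ k = a.right) ∧ (k = b.left ∨ k = b.right) := by
    intro k l₁ l₂ l₃ r₁ r₂ r₃ h0
    have e₁ := hab k l₁ l₂ r₁ r₂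
    have e₂ := hbc k l₂ l₃ r₂ r₃
    have e₃ := hca k l₃ l₁ r₃ r₁
    have e₄ : a.letter k = b.letter k := le_antisymm e₁ (e₂.trans e₃)
    have e₅ : b.letter k = c.letter k := le_antisymm e₂ (e₃.trans e₁)
    have e₆ : a.letter k = 0 := by
      rcases h0 with h0 | h0 | h0
      · exact h0
      · exact e₄.trans h0
      · exact e₄.trans (e₅.trans h0)
    exact ⟨eq_left_or_right_of_letter_eq_zero e₆ l₁ r₁,
      eq_left_or_right_of_letter_eq_zero (e₄ ▸ e₆) l₂ r₂⟩
  have hA : ∃ k, (k = a.left ∨ k = b.left ∨ k = c.left) ∧ a.left ≤ k ∧ b.left ≤ k ∧ c.left ≤ k :=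
    ⟨max a.left (max b.left c.left), by omega⟩
  have hB : ∃ k, (k = a.right ∨ k = b.right ∨ k = c.right) ∧
      k ≤ a.right ∧ k ≤ b.right ∧ k ≤ c.right :=
    ⟨min a.right (min b.right c.right), by omega⟩
  obtain ⟨A, hA, hA₁, hA₂, hA₃⟩ := hA
  obtain ⟨B, hB, hB₁, hB₂, hB₃⟩ := hB
  have kA := key A hA₁ hA₂ hA₃ (by omega) (by omega) (by omega) (by
    rcases hA with h | h | h
    · exact .inl (h ▸ a.letter_left)
    · exact .inr (.inl (h ▸ b.letter_left))
    · exact .inr (.inr (h ▸ c.letter_left)))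
  have kB := key B (by omega) (by omega) (by omega) hB₁ hB₂ hB₃ (by
    rcases hB with h | h | h
    · exact .inl (h ▸ a.letter_right)
    · exact .inr (.inl (h ▸ b.letter_right))
    · exact .inr (.inr (h ▸ c.letter_right)))
  omega

theorem Noncrossing.not_isBelow {a b : Arc n} (h : a.Noncrossing b) (hab : a.IsBelow b) :
    ¬ b.IsBelow a := fun hba =>
  h.endpoints_ne (hab.endpoints_eq_of_cycle hba (IsBelow.refl a))

theorem Noncrossing.isBelow_of_letter_lt {a b : Arc n} (h : a.Noncrossing b) {k : ℕ}
    (h₁ : a.left ≤ k) (h₂ : b.left ≤ k) (h₃ : k ≤ a.right) (h₄ : k ≤ b.right)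
    (hk : a.letter k < b.letter k) : a.IsBelow b := by
  have := h.right_ne_left
  have := h.left_ne_right
  rcases h.isBelow_or_isBelow (by omega) (by omega) with h' | h'
  · exact h'
  · exact absurd (h'.2.2 k h₂ h₁ h₄ h₃) (not_le.2 hk)

end Arc

/-- By the intermediate value theorem, curves that do not cross are comparable over their common
interval, so that their letters are. -/
theorem Curve.MeetAtMostOnce.noncrossing {n : ℕ} {γ ρ : Curve n} {a b : Arc n}
    (h : γ.MeetAtMostOnce ρ) (hγ : Arc.IsRep γ a) (hρ : Arc.IsRep ρ b) : a.Noncrossing b := by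
  have hγ' := γ.left_lt_right
  have hρ' := ρ.left_lt_right
  obtain ⟨hne, hmeet⟩ := h
  constructor
  · rwa [← hγ.left_eq, ← hγ.right_eq, ← hρ.left_eq, ← hρ.right_eq]
  · rw [← hγ.right_eq, ← hρ.left_eq]
    intro he
    have := hmeet γ.right ⟨by exact_mod_cast hγ'.le, le_rfl⟩
      ⟨by exact_mod_cast he.ge, by exact_mod_cast (he ▸ hρ'.le : γ.right ≤ ρ.right)⟩
      (by rw [γ.map_right, he, ρ.map_left])
    norm_cast at this
    omega
  · rw [← hγ.left_eq, ← hρ.right_eq]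
    intro he
    have := hmeet γ.left ⟨le_rfl, by exact_mod_cast hγ'.le⟩
      ⟨by exact_mod_cast (he ▸ hρ'.le : ρ.left ≤ γ.left), by exact_mod_cast he.le⟩
      (by rw [γ.map_left, he, ρ.map_right])
    norm_cast at this
    omega
  · intro h₁ h₂
    have hcmp : (∀ x ∈ Set.Icc (γ.left : ℝ) γ.right, x ∈ Set.Icc (ρ.left : ℝ) ρ.right →
        γ.toFun x ≤ ρ.toFun x) ∨ (∀ x ∈ Set.Icc (γ.left : ℝ) γ.right,
        x ∈ Set.Icc (ρ.left : ℝ) ρ.right → ρ.toFun x ≤ γ.toFun x) := by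
      by_contra! hcon
      obtain ⟨⟨x, hx₁, hx₂, hx⟩, ⟨y, hy₁, hy₂, hy⟩⟩ := hcon
      have hs₁ := Set.uIcc_subset_Icc hx₁ hy₁
      have hs₂ := Set.uIcc_subset_Icc hx₂ hy₂
      obtain ⟨z, hz, hzz⟩ := isPreconnected_uIcc.intermediate_value₂ Set.right_mem_uIcc
        Set.left_mem_uIcc (γ.continuousOn.mono hs₁) (ρ.continuousOn.mono hs₂) hy.le hx.le
      have hzx : z ≠ x := by rintro rfl; exact hx.ne' hzz
      have hzy : z ≠ y := by rintro rfl; exact hy.ne hzz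
      have := hmeet z (hs₁ hz) (hs₂ hz) hzz
      have hz' : (x < z ∧ z < y) ∨ (y < z ∧ z < x) := by
        rcases Set.mem_uIcc.1 hz with h | h
        · exact .inl ⟨lt_of_le_of_ne h.1 hzx.symm, lt_of_le_of_ne h.2 hzy⟩
        · exact .inr ⟨lt_of_le_of_ne h.1 hzy.symm, lt_of_le_of_ne h.2 hzx⟩
      have a₁ := hx₁.1
      have a₂ := hx₁.2
      have a₃ := hy₁.1
      have a₄ := hy₁.2
      rcases this with ⟨h, -⟩ | ⟨h, -⟩ <;> rcases hz' with ⟨_, _⟩ | ⟨_, _⟩ <;> linarith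
    have hmem : ∀ {c d k : ℕ}, c ≤ k → k ≤ d → (k : ℝ) ∈ Set.Icc (c : ℝ) d := fun hc hd =>
      ⟨by exact_mod_cast hc, by exact_mod_cast hd⟩
    refine hcmp.imp (fun hc => ⟨h₁, h₂, fun k l₁ l₂ r₁ r₂ => ?_⟩)
      (fun hc => ⟨h₂, h₁, fun k l₁ l₂ r₁ r₂ => ?_⟩)
    · rw [← hγ.letter_eq l₁ r₁, ← hρ.letter_eq l₂ r₂]
      rw [← hγ.left_eq] at l₁
      rw [← hγ.right_eq] at r₁
      rw [← hρ.left_eq] at l₂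
      rw [← hρ.right_eq] at r₂
      exact SignType.sign.monotone (hc k (hmem l₁ r₁) (hmem l₂ r₂))
    · rw [← hγ.letter_eq l₂ r₂, ← hρ.letter_eq l₁ r₁]
      rw [← hγ.left_eq] at l₂
      rw [← hγ.right_eq] at r₂
      rw [← hρ.left_eq] at l₁
      rw [← hρ.right_eq] at r₁
      exact SignType.sign.monotone (hc k (hmem l₂ r₂) (hmem l₁ r₁))

/-! ### Simultaneous representatives -/

theorem Curve.MeetAtMostOnce.symm {n : ℕ} {γ ρ : Curve n} (h : γ.MeetAtMostOnce ρ) :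
    ρ.MeetAtMostOnce γ :=
  ⟨fun h' => h.1 ⟨h'.1.symm, h'.2.symm⟩, fun x h₁ h₂ hx =>
    (h.2 x h₂ h₁ hx.symm).imp And.symm And.symm⟩

/-- The piecewise linear hat function at the node `m`. -/
noncomputable def hat (m : ℕ) (x : ℝ) : ℝ := max 0 (1 - |x - m|)

theorem hat_nonneg (m : ℕ) (x : ℝ) : 0 ≤ hat m x := le_max_left _ _

theorem hat_pos {m : ℕ} {x : ℝ} (h : |x - m| < 1) : 0 < hat m x :=
  lt_max_of_lt_right (by linarith)

theorem hat_eq_zero {m : ℕ} {x : ℝ} (h : 1 ≤ |x - m|) : hat m x = 0 :=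
  max_eq_left (by linarith)

/-- The piecewise linear function with the values `h 0, …, h n` at the nodes. -/
noncomputable def interp (n : ℕ) (h : ℕ → ℝ) (x : ℝ) : ℝ :=
  ∑ m ∈ Finset.range (n + 1), h m * hat m x

theorem continuous_interp (n : ℕ) (h : ℕ → ℝ) : Continuous (interp n h) := by
  unfold interp hat
  fun_prop

theorem interp_natCast {n k : ℕ} (hk : k ≤ n) (h : ℕ → ℝ) : interp n h k = h k := by
  unfold interp
  rw [Finset.sum_eq_single k]
  · simp [hat]
  · intro m _ hm
    rw [hat_eq_zero, mul_zero]
    have : (1 : ℤ) ≤ |(k : ℤ) - m| := Int.one_le_abs (by omega)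
    exact_mod_cast this
  · intro hk'
    exact absurd (Finset.mem_range.2 (by omega)) hk'

theorem interp_lt_interp {n a b m : ℕ} {h h' : ℕ → ℝ} {x : ℝ} (ha : (a : ℝ) ≤ x) (hb : x ≤ b)
    (hle : ∀ k, a ≤ k → k ≤ b → h k ≤ h' k) (hm : m ≤ n) (hx : |x - m| < 1) (hlt : h m < h' m) :
    interp n h x < interp n h' x := by
  refine Finset.sum_lt_sum (fun k _ => ?_)
    ⟨m, Finset.mem_range.2 (by omega), mul_lt_mul_of_pos_right hlt (hat_pos hx)⟩
  -- the hats that do not vanish at `x` belong to nodes of `[a, b]`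
  by_cases hk : |x - k| < 1
  · rw [abs_lt] at hk
    refine mul_le_mul_of_nonneg_right (hle k ?_ ?_) (hat_nonneg _ _)
    · have : (a : ℝ) < k + 1 := by linarith
      norm_cast at this
      omega
    · have : (k : ℝ) < b + 1 := by linarith
      norm_cast at this
      omega
  · rw [hat_eq_zero (not_lt.1 hk), mul_zero, mul_zero]

variable {n k : ℕ}

open Classical in
/-- The number of arcs of the family that pass the node `v` and lie below `ω i`, with `ω i` itself
counted if it passes `v`. -/
noncomputable def depth (ω : Fin k → Arc n) (i : Fin k) (v : ℕ) : ℕ :=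
  (Finset.univ.filter fun m => (ω m).letter v ≠ 0 ∧ (ω m).IsBelow (ω i)).card

/-- The height at the node `v` of the simultaneous representative of `ω i`: arcs above and below the
node are kept apart, and those on the same side are stacked according to `Arc.IsBelow`. The summand
`± (k + 1)` outweighs the depth, which is at most `k`, so that the sign is the letter. -/
noncomputable def height (ω : Fin k → Arc n) (i : Fin k) (v : ℕ) : ℝ :=
  if (ω i).letter v = 0 then 0 else ((ω i).letter v : ℝ) * (k + 1) + depth ω i v

theorem depth_le (ω : Fin k → Arc n) (i : Fin k) (v : ℕ) : depth ω i v ≤ k := by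
  classical
  simpa [depth] using Finset.card_le_univ
    (Finset.univ.filter fun m => (ω m).letter v ≠ 0 ∧ (ω m).IsBelow (ω i))

theorem sign_height (ω : Fin k → Arc n) (i : Fin k) (v : ℕ) :
    SignType.sign (height ω i v) = (ω i).letter v := by
  have hd : (depth ω i v : ℝ) ≤ k := by exact_mod_cast depth_le ω i v
  have hd' : (0 : ℝ) ≤ depth ω i v := by positivity
  unfold height
  rcases (ω i).letter v with _ | _ | _
  · simp
  · rw [if_neg (by decide)]
    refine sign_neg ?_
    simp only [SignType.neg_eq_neg_one, SignType.coe_neg_one]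
    linarith
  · rw [if_neg (by decide)]
    refine sign_pos ?_
    simp only [SignType.pos_eq_one, SignType.coe_one]
    linarith

theorem depth_lt_depth {ω : Fin k → Arc n} (hω : ∀ i j, i ≠ j → (ω i).Noncrossing (ω j))
    {i j : Fin k} (hij : i ≠ j) (hb : (ω i).IsBelow (ω j)) {v : ℕ} (hj : (ω j).letter v ≠ 0) :
    depth ω i v < depth ω j v := by
  classical
  refine Finset.card_lt_card (Finset.ssubset_iff_subset_ne.2 ⟨fun m hm => ?_, fun he => ?_⟩)
  · simp only [Finset.mem_filter, Finset.mem_univ, true_and] at hm ⊢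
    refine ⟨hm.1, ?_⟩
    obtain rfl | hmj := eq_or_ne m j
    · exact Arc.IsBelow.refl _
    have h₁ := (Arc.letter_ne_zero_iff _ _).1 hm.1
    have h₂ := (Arc.letter_ne_zero_iff _ _).1 hj
    refine ((hω m j hmj).isBelow_or_isBelow (by omega) (by omega)).resolve_right fun h => ?_
    exact (hω i j hij).endpoints_ne (hb.endpoints_eq_of_cycle h hm.2)
  · have : j ∈ Finset.univ.filter fun m => (ω m).letter v ≠ 0 ∧ (ω m).IsBelow (ω i) := by
      rw [he]
      simpa using ⟨hj, Arc.IsBelow.refl _⟩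
    exact (hω i j hij).not_isBelow hb (Finset.mem_filter.1 this).2.2

theorem height_lt_height {ω : Fin k → Arc n} (hω : ∀ i j, i ≠ j → (ω i).Noncrossing (ω j))
    {i j : Fin k} (hij : i ≠ j) (hb : (ω i).IsBelow (ω j)) {v : ℕ} (h₁ : (ω i).left ≤ v)
    (h₂ : (ω j).left ≤ v) (h₃ : v ≤ (ω i).right) (h₄ : v ≤ (ω j).right)
    (hne : ¬ ((ω i).letter v = 0 ∧ (ω j).letter v = 0)) : height ω i v < height ω j v := by
  rcases (hb.2.2 v h₁ h₂ h₃ h₄).lt_or_eq with h | h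
  · by_contra! hle
    have := SignType.sign.monotone hle
    rw [sign_height, sign_height] at this
    exact absurd h (not_lt.2 this)
  · have hi : (ω i).letter v ≠ 0 := fun h0 => hne ⟨h0, h ▸ h0⟩
    have := depth_lt_depth hω hij hb (h ▸ hi)
    rw [height, height, if_neg hi, if_neg (h ▸ hi), h]
    gcongr

theorem height_le_height {ω : Fin k → Arc n} (hω : ∀ i j, i ≠ j → (ω i).Noncrossing (ω j))
    {i j : Fin k} (hij : i ≠ j) (hb : (ω i).IsBelow (ω j)) {v : ℕ} (h₁ : (ω i).left ≤ v)
    (h₂ : (ω j).left ≤ v) (h₃ : v ≤ (ω i).right) (h₄ : v ≤ (ω j).right) :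
    height ω i v ≤ height ω j v := by
  by_cases hne : (ω i).letter v = 0 ∧ (ω j).letter v = 0
  · simp [height, hne.1, hne.2]
  · exact (height_lt_height hω hij hb h₁ h₂ h₃ h₄ hne).le

/-- The piecewise linear curve through the heights of the arc `ω i`. -/
noncomputable def stackedCurve (ω : Fin k → Arc n) (i : Fin k) : Curve n where
  left := (ω i).left
  right := (ω i).right
  left_lt_right := (ω i).left_lt_right
  right_le := (ω i).right_le
  toFun := interp n (height ω i)
  continuousOn := (continuous_interp _ _).continuousOn
  map_left := by
    rw [interp_natCast ((ω i).left_lt_right.le.trans (ω i).right_le), height,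
      if_pos (ω i).letter_left]
  map_right := by rw [interp_natCast (ω i).right_le, height, if_pos (ω i).letter_right]
  map_ne_zero v h₁ h₂ := by
    rw [interp_natCast (h₂.le.trans (ω i).right_le), ← sign_ne_zero, sign_height]
    exact ((ω i).letter_ne_zero_iff v).2 ⟨h₁, h₂⟩

theorem isRep_stackedCurve (ω : Fin k → Arc n) (i : Fin k) :
    Arc.IsRep (stackedCurve ω i) (ω i) := by
  refine Arc.isRep_of_letter_eq rfl rfl fun v _ hv => ?_
  change SignType.sign (interp n (height ω i) v) = _
  rw [interp_natCast (hv.trans (ω i).right_le), sign_height]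

theorem stackedCurve_meetAtMostOnce_of_isBelow {ω : Fin k → Arc n}
    (hω : ∀ i j, i ≠ j → (ω i).Noncrossing (ω j)) {i j : Fin k} (hij : i ≠ j)
    (hb : (ω i).IsBelow (ω j)) : (stackedCurve ω i).MeetAtMostOnce (stackedCurve ω j) := by
  have hnc := hω i j hij
  refine ⟨hnc.endpoints_ne, fun x hx₁ hx₂ hx => ?_⟩
  change x ∈ Set.Icc ((ω i).left : ℝ) (ω i).right at hx₁
  change x ∈ Set.Icc ((ω j).left : ℝ) (ω j).right at hx₂
  change interp n (height ω i) x = interp n (height ω j) x at hx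
  change (x = (ω i).left ∧ x = (ω j).left) ∨ (x = (ω i).right ∧ x = (ω j).right)
  -- the heights agree at the nodes next to `x`
  have key : ∀ v : ℕ, (ω i).left ≤ v → (ω j).left ≤ v → v ≤ (ω i).right → v ≤ (ω j).right →
      |x - v| < 1 → (v = (ω i).left ∨ v = (ω i).right) ∧ (v = (ω j).left ∨ v = (ω j).right) := by
    intro v l₁ l₂ r₁ r₂ hv
    by_cases hne : (ω i).letter v = 0 ∧ (ω j).letter v = 0
    · exact ⟨Arc.eq_left_or_right_of_letter_eq_zero hne.1 l₁ r₁,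
        Arc.eq_left_or_right_of_letter_eq_zero hne.2 l₂ r₂⟩
    · refine absurd hx (interp_lt_interp (a := max (ω i).left (ω j).left)
        (b := min (ω i).right (ω j).right) ?_ ?_ (fun w hw₁ hw₂ => ?_)
        (r₁.trans (ω i).right_le) hv (height_lt_height hω hij hb l₁ l₂ r₁ r₂ hne)).ne
      · push_cast
        exact max_le hx₁.1 hx₂.1
      · push_cast
        exact le_min hx₁.2 hx₂.2
      · exact height_le_height hω hij hb (by omega) (by omega) (by omega) (by omega)
  have h0 : 0 ≤ x := le_trans (by positivity) hx₁.1
  have hfl : (⌊x⌋₊ : ℝ) ≤ x := Nat.floor_le h0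
  have hfl' : x < ⌊x⌋₊ + 1 := Nat.lt_floor_add_one x
  have l₁ : (ω i).left ≤ ⌊x⌋₊ := Nat.le_floor hx₁.1
  have l₂ : (ω j).left ≤ ⌊x⌋₊ := Nat.le_floor hx₂.1
  have r₁ : ⌊x⌋₊ ≤ (ω i).right := Nat.floor_le_of_le hx₁.2
  have r₂ : ⌊x⌋₊ ≤ (ω j).right := Nat.floor_le_of_le hx₂.2
  have hv := key ⌊x⌋₊ l₁ l₂ r₁ r₂ (by rw [abs_lt]; constructor <;> linarith)
  have := hnc.right_ne_left
  have := hnc.left_ne_right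
  rcases hfl.eq_or_lt with he | hlt
  · rw [← he]
    norm_cast
    omega
  · have s₁ : ⌊x⌋₊ < (ω i).right := by exact_mod_cast hlt.trans_le hx₁.2
    have s₂ : ⌊x⌋₊ < (ω j).right := by exact_mod_cast hlt.trans_le hx₂.2
    have hv' := key (⌊x⌋₊ + 1) (by omega) (by omega) s₁ s₂
      (by rw [abs_lt]; push_cast; constructor <;> linarith)
    exact absurd (by omega) hnc.endpoints_ne

/-- Pairwise non-crossing arcs have representatives, fixed simultaneously, that do not cross. -/
theorem stackedCurve_meetAtMostOnce {ω : Fin k → Arc n}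
    (hω : ∀ i j, i ≠ j → (ω i).Noncrossing (ω j)) {i j : Fin k} (hij : i ≠ j) :
    (stackedCurve ω i).MeetAtMostOnce (stackedCurve ω j) := by
  have hnc := hω i j hij
  by_cases ho : (ω i).left < (ω j).right ∧ (ω j).left < (ω i).right
  · rcases hnc.isBelow_or_isBelow ho.1 ho.2 with h | h
    · exact stackedCurve_meetAtMostOnce_of_isBelow hω hij h
    · exact (stackedCurve_meetAtMostOnce_of_isBelow hω hij.symm h).symm
  · refine ⟨hnc.endpoints_ne, fun x hx₁ hx₂ _ => absurd ?_ ho⟩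
    have h₁ : (ω i).left ≤ (ω j).right := by exact_mod_cast hx₁.1.trans hx₂.2
    have h₂ : (ω j).left ≤ (ω i).right := by exact_mod_cast hx₂.1.trans hx₁.2
    have := hnc.right_ne_left
    have := hnc.left_ne_right
    omega

/-! ### Clockwise order at a left endpoint -/

theorem IsClockwiseOrdered.noncrossing {ω : Fin k → Arc n} (h : IsClockwiseOrdered ω)
    (i j : Fin k) (hij : i ≠ j) : (ω i).Noncrossing (ω j) := by
  rcases hij.lt_or_gt with hlt | hlt
  · obtain ⟨γ, ρ, hγ, hρ, hm⟩ := h.meetAtMostOnce i j hlt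
    exact hm.noncrossing hγ hρ
  · obtain ⟨γ, ρ, hγ, hρ, hm⟩ := h.meetAtMostOnce j i hlt
    exact (hm.noncrossing hγ hρ).symm

/-- Around a common left endpoint the arcs are listed from top to bottom. -/
theorem IsClockwiseOrdered.isBelow {ω : Fin k → Arc n} (h : IsClockwiseOrdered ω)
    {i j : Fin k} (hij : i < j) (hl : (ω i).left = (ω j).left) : (ω j).IsBelow (ω i) := by
  have hnc := h.noncrossing j i hij.ne'
  have hi := (ω i).left_lt_right
  have hj := (ω j).left_lt_right
  rcases h.clockwise i j hij (.inl hl) with ⟨-, ⟨hr, hp⟩ | ⟨hr, hp⟩⟩ | ⟨hr, -⟩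
  · rw [Arc.passesBelow_iff] at hp
    refine hnc.isBelow_of_letter_lt (k := (ω i).right) (by omega) (by omega) (by omega)
      (by omega) ?_
    rw [hp, Arc.letter_right]
    decide
  · rw [Arc.passesAbove_iff] at hp
    refine hnc.isBelow_of_letter_lt (k := (ω j).right) (by omega) (by omega) (by omega)
      (by omega) ?_
    rw [hp, Arc.letter_right]
    decide
  · exact absurd ⟨hl.symm, hr.symm⟩ hnc.endpoints_ne

/-! ### The graph of a diagram -/

/-- The edge of `graph ω` that is given by the arc `ω i`. -/
def edge (ω : Fin k → Arc n) (i : Fin k) : Sym2 (Fin (n + 1)) :=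
  s(⟨(ω i).left, by have := (ω i).left_lt_right; have := (ω i).right_le; omega⟩,
    ⟨(ω i).right, by have := (ω i).right_le; omega⟩)

theorem edgeSet_graph (ω : Fin k → Arc n) : (graph ω).edgeSet = Set.range (edge ω) := by
  ext e
  induction e using Sym2.ind with
  | _ p q =>
    rw [SimpleGraph.mem_edgeSet]
    simp only [graph, Set.mem_range, edge, Sym2.eq_iff, Fin.ext_iff]

theorem edge_injective {ω : Fin k → Arc n} (hω : ∀ i j, i ≠ j → (ω i).Noncrossing (ω j)) :
    Function.Injective (edge ω) := by
  intro i j h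
  by_contra hij
  simp only [edge, Sym2.eq_iff, Fin.mk.injEq] at h
  rcases h with h | h
  · exact (hω i j hij).endpoints_ne h
  · exact (hω i j hij).left_ne_right h.1

theorem ncard_edgeSet_graph {ω : Fin k → Arc n} (hω : ∀ i j, i ≠ j → (ω i).Noncrossing (ω j)) :
    (graph ω).edgeSet.ncard = k := by
  rw [edgeSet_graph, ← Set.image_univ, Set.ncard_image_of_injective _ (edge_injective hω),
    Set.ncard_univ, Nat.card_eq_fintype_card, Fintype.card_fin]

theorem left_ne_right {ω : Fin k → Arc n} (hω : ∀ i j, i ≠ j → (ω i).Noncrossing (ω j))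
    (i j : Fin k) : (ω i).left ≠ (ω j).right := by
  obtain rfl | hij := eq_or_ne i j
  · exact (ω i).left_lt_right.ne
  · exact (hω i j hij).left_ne_right

/-- No node is a left endpoint and a right endpoint, which gives the two colours. -/
theorem isBipartite_graph {ω : Fin k → Arc n} (hω : ∀ i j, i ≠ j → (ω i).Noncrossing (ω j)) :
    (graph ω).IsBipartite := by
  classical
  refine ⟨SimpleGraph.Coloring.mk
    (fun p : Fin (n + 1) => if ∃ i, (ω i).left = p then (0 : Fin 2) else 1) ?_⟩
  have key : ∀ (i : Fin k), ¬ ∃ j, (ω j).left = (ω i).right := fun i ⟨j, hj⟩ =>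
    left_ne_right hω j i hj
  rintro p q ⟨i, ⟨h₁, h₂⟩ | ⟨h₁, h₂⟩⟩
  · rw [if_pos ⟨i, h₁⟩, if_neg (h₂ ▸ key i)]
    decide
  · rw [if_pos (⟨i, h₁⟩ : ∃ i, (ω i).left = q), if_neg (h₂ ▸ key i)]
    decide

/-- The graphs of representatives that do not cross are a plane drawing. -/
theorem isPlanar_graph {ω : Fin k → Arc n} {γ : Fin k → Curve n}
    (hrep : ∀ i, Arc.IsRep (γ i) (ω i)) (hγ : ∀ i j, i ≠ j → (γ i).MeetAtMostOnce (γ j)) :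
    IsPlanar (graph ω) := by
  have hex : ∀ e : (graph ω).edgeSet, ∃ i, edge ω i = e := fun e =>
    (Set.ext_iff.1 (edgeSet_graph ω) e).1 e.2
  choose idx hidx using hex
  let X : Fin k → unitInterval → ℝ := fun i t =>
    (γ i).left + t * ((γ i).right - (γ i).left)
  have hlt : ∀ i, ((γ i).left : ℝ) < (γ i).right := fun i => by
    exact_mod_cast (γ i).left_lt_right
  have hX : ∀ i t, X i t ∈ Set.Icc ((γ i).left : ℝ) (γ i).right := fun i t => by
    have := hlt i
    have := t.2.1
    have := t.2.2
    constructor <;> simp only [X] <;> nlinarith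
  have hX' : ∀ i, ∀ t ∈ Set.Ioo (0 : unitInterval) 1,
      X i t ∈ Set.Ioo ((γ i).left : ℝ) (γ i).right := fun i t ht => by
    have := hlt i
    have h₁ : (0 : ℝ) < t := ht.1
    have h₂ : (t : ℝ) < 1 := ht.2
    constructor <;> simp only [X] <;> nlinarith
  refine ⟨fun v => ((v : ℕ), 0), fun e t => (X (idx e) t, (γ (idx e)).toFun (X (idx e) t)),
    ?_, ?_, ?_, ?_, ?_⟩
  · intro v w h
    simpa [Fin.ext_iff] using h
  · refine fun e => ⟨?_, fun s t hst => ?_⟩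
    · have hc : Continuous (X (idx e)) := by fun_prop
      exact hc.prodMk ((γ (idx e)).continuousOn.comp_continuous hc (hX _))
    · have h := (Prod.ext_iff.1 hst).1
      have := hlt (idx e)
      simp only [X, add_right_inj] at h
      exact Subtype.ext (mul_right_cancel₀ (by linarith) h)
  · refine fun e => ⟨_, _, (hidx e).symm, ?_, ?_⟩
    · simp [X, (γ (idx e)).map_left, ← (hrep (idx e)).left_eq]
    · simp [X, (γ (idx e)).map_right, ← (hrep (idx e)).right_eq]
  · rintro e t ht ⟨v, hv⟩
    obtain ⟨h₁, h₂⟩ := Prod.ext_iff.1 hv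
    have h₃ := hX' (idx e) t ht
    simp only at h₁ h₂
    rw [← h₁] at h₂ h₃
    exact (γ (idx e)).map_ne_zero v (by exact_mod_cast h₃.1) (by exact_mod_cast h₃.2) h₂.symm
  · intro e f hef
    have hne : idx e ≠ idx f := fun h => hef (Subtype.ext (by rw [← hidx e, ← hidx f, h]))
    rw [Set.disjoint_left]
    rintro _ ⟨s, hs, rfl⟩ ⟨t, ht, hst⟩
    obtain ⟨h₁, h₂⟩ := Prod.ext_iff.1 hst
    simp only at h₁ h₂
    have hs' := hX' (idx e) s hs
    have ht' := hX' (idx f) t ht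
    rw [h₁] at h₂ ht'
    rcases (hγ _ _ hne).2 _ ⟨hs'.1.le, hs'.2.le⟩ ⟨ht'.1.le, ht'.2.le⟩ h₂.symm with h | h
    · exact hs'.1.ne' h.1
    · exact hs'.2.ne h.1

/-! ### The bound on the length -/

/-- The arc `ω j` is the next one above `ω i` at their common left endpoint, and `w` is the first
node to the right of that endpoint that lies in the closed region between the two arcs. -/
structure IsWedge (ω : Fin k → Arc n) (i j : Fin k) (w : ℕ) : Prop where
  ne : i ≠ j
  left_eq : (ω i).left = (ω j).left
  isBelow : (ω i).IsBelow (ω j)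
  consecutive : ∀ m, (ω m).left = (ω i).left → m ≠ i → m ≠ j → (ω i).IsBelow (ω m) →
    ¬ (ω m).IsBelow (ω j)
  left_lt : (ω i).left < w
  le_right_lower : w ≤ (ω i).right
  le_right_upper : w ≤ (ω j).right
  letter_lower : (ω i).letter w ≤ 0
  letter_upper : 0 ≤ (ω j).letter w
  first : ∀ v, (ω i).left < v → v < w → (ω i).letter v ≤ 0 → ¬ 0 ≤ (ω j).letter v

theorem IsClockwiseOrdered.exists_isWedge {ω : Fin k → Arc n} (h : IsClockwiseOrdered ω)
    {i : Fin k} (hi : ∃ j < i, (ω j).left = (ω i).left) : ∃ j w, IsWedge ω i j w := by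
  classical
  have hne : (Finset.univ.filter fun j => j < i ∧ (ω j).left = (ω i).left).Nonempty := by
    obtain ⟨j, hj⟩ := hi
    exact ⟨j, by simpa using hj⟩
  obtain ⟨j, hj, hmax⟩ := Finset.exists_max_image _ id hne
  simp only [Finset.mem_filter, Finset.mem_univ, true_and, id_eq] at hj hmax
  obtain ⟨hji, hl⟩ := hj
  have hb := h.isBelow hji hl
  have hi' := (ω i).left_lt_right
  have hj' := (ω j).left_lt_right
  -- the first of the two right endpoints lies in the closed region
  have hex : ∃ w, (ω i).left < w ∧ w ≤ (ω i).right ∧ w ≤ (ω j).right ∧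
      (ω i).letter w ≤ 0 ∧ 0 ≤ (ω j).letter w := by
    rcases le_total (ω i).right (ω j).right with hr | hr
    · refine ⟨(ω i).right, hi', le_rfl, hr, (ω i).letter_right.le, ?_⟩
      rw [← (ω i).letter_right]
      exact hb.2.2 _ (by omega) (by omega) le_rfl hr
    · refine ⟨(ω j).right, by omega, hr, le_rfl, ?_, (ω j).letter_right.ge⟩
      rw [← (ω j).letter_right]
      exact hb.2.2 _ (by omega) (by omega) hr le_rfl
  obtain ⟨h₁, h₂, h₃, h₄, h₅⟩ := Nat.find_spec hex
  refine ⟨j, Nat.find hex, hji.ne', hl.symm, hb, fun m hm hmi hmj him hmj' => ?_, h₁, h₂, h₃, h₄, h₅,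
    fun v hv hv' h₆ h₇ => Nat.find_min hex hv' ⟨hv, by omega, by omega, h₆, h₇⟩⟩
  have hmi' : m < i := by
    by_contra hle
    have hlt : i < m := lt_of_le_of_ne (not_lt.1 hle) hmi.symm
    exact (h.noncrossing i m hlt.ne).not_isBelow him (h.isBelow hlt hm.symm)
  have hjm : m < j := lt_of_le_of_ne (hmax m ⟨hmi', hm⟩) hmj
  exact (h.noncrossing m j hmj).not_isBelow hmj' (h.isBelow hjm (hm.trans hl.symm))

/-- The region of a wedge contains no arc before its first node. -/
theorem IsWedge.not_between {ω : Fin k → Arc n} {i j m : Fin k} {w : ℕ} (h : IsWedge ω i j w)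
    (hmi : m ≠ i) (hmj : m ≠ j) (him : (ω i).IsBelow (ω m)) (hmw : (ω m).left < w)
    (hw : w ≤ (ω m).right) : ¬ (ω m).IsBelow (ω j) := by
  intro hmj'
  have hl := h.left_eq
  have h₁ := h.left_lt
  have h₂ := h.le_right_lower
  have h₃ := h.le_right_upper
  rcases lt_trichotomy (ω m).left (ω i).left with hlt | heq | hgt
  · refine ((ω m).letter_ne_zero_iff (ω i).left).2 ⟨hlt, by omega⟩ (le_antisymm ?_ ?_)
    · have := hmj'.2.2 (ω i).left hlt.le (by omega) (by omega) (by omega)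
      rwa [hl, (ω j).letter_left, ← hl] at this
    · have := him.2.2 (ω i).left le_rfl hlt.le (by omega) (by omega)
      rwa [(ω i).letter_left] at this
  · exact h.consecutive m heq hmi hmj him hmj'
  · refine h.first (ω m).left hgt hmw ?_ ?_
    · rw [← (ω m).letter_left]
      exact him.2.2 _ (by omega) (by omega) (by omega) (by omega)
    · rw [← (ω m).letter_left]
      exact hmj'.2.2 _ (by omega) (by omega) (by omega) (by omega)

theorem IsWedge.letter_lt {ω : Fin k → Arc n} (hω : ∀ i j, i ≠ j → (ω i).Noncrossing (ω j))
    {i j : Fin k} {w : ℕ} (h : IsWedge ω i j w) : (ω i).letter w < (ω j).letter w := by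
  have hl := h.left_eq
  have h₁ := h.left_lt
  have h₂ := h.le_right_lower
  have h₃ := h.le_right_upper
  refine lt_of_le_of_ne (h.letter_lower.trans h.letter_upper) fun he => ?_
  have hi : (ω i).letter w = 0 := le_antisymm h.letter_lower (he ▸ h.letter_upper)
  have hi' := Arc.eq_left_or_right_of_letter_eq_zero hi h₁.le h₂
  have hj' := Arc.eq_left_or_right_of_letter_eq_zero (he ▸ hi) (by omega) h₃
  exact (hω i j h.ne).endpoints_ne (by omega)

theorem IsWedge.lower_unique {ω : Fin k → Arc n} (hω : ∀ i j, i ≠ j → (ω i).Noncrossing (ω j))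
    {i j i' j' : Fin k} {w : ℕ} (h : IsWedge ω i j w) (h' : IsWedge ω i' j' w)
    (he : (ω i).letter w = (ω i').letter w) : i = i' := by
  by_contra hne
  have aux : ∀ {i j i' j' : Fin k}, i ≠ i' → IsWedge ω i j w → IsWedge ω i' j' w →
      (ω i).letter w = (ω i').letter w → ¬ (ω i).IsBelow (ω i') := by
    intro i j i' j' hne h h' he hb
    have hlt := h.letter_lt hω
    rw [he] at hlt
    have hij : i' ≠ j := by rintro rfl; exact lt_irrefl _ hlt
    have hl := h.left_eq
    have h₁ := h.left_lt
    have h₃ := h.le_right_upper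
    have h₄ := h'.left_lt
    have h₅ := h'.le_right_lower
    exact h.not_between hne.symm hij hb h₄ h₅
      ((hω i' j hij).isBelow_of_letter_lt h₄.le (by omega) h₅ h₃ hlt)
  have h₁ := h.left_lt
  have h₂ := h.le_right_lower
  have h₃ := h'.left_lt
  have h₄ := h'.le_right_lower
  rcases (hω i i' hne).isBelow_or_isBelow (by omega) (by omega) with hb | hb
  · exact aux hne h h' he hb
  · exact aux (Ne.symm hne) h' h he.symm hb

/-- The slot of the arc `ω i`, a node with a flag: the topmost arc at a left endpoint takes that
endpoint, any other arc takes the first node of the wedge above it, the flag recording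
whether it ends there. In a clockwise-ordered diagram the arcs at a left endpoint are listed from top
to bottom, so the topmost one is the one with the least index. -/
def IsSlot (ω : Fin k → Arc n) (i : Fin k) (p : ℕ × Bool) : Prop :=
  (p = ((ω i).left, true) ∧ ¬ ∃ j < i, (ω j).left = (ω i).left) ∨
    ∃ j w, IsWedge ω i j w ∧ p = (w, decide ((ω i).letter w = 0))

theorem IsClockwiseOrdered.exists_isSlot {ω : Fin k → Arc n} (h : IsClockwiseOrdered ω)
    (i : Fin k) : ∃ p, IsSlot ω i p := by
  by_cases hi : ∃ j < i, (ω j).left = (ω i).left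
  · obtain ⟨j, w, hw⟩ := h.exists_isWedge hi
    exact ⟨_, .inr ⟨j, w, hw, rfl⟩⟩
  · exact ⟨_, .inl ⟨rfl, hi⟩⟩

/-- A node that is a left endpoint is not a right endpoint, so the slots of the two kinds differ. -/
theorem IsWedge.slot_ne {ω : Fin k → Arc n} (hω : ∀ i j, i ≠ j → (ω i).Noncrossing (ω j))
    {i j : Fin k} {w : ℕ} (h : IsWedge ω i j w) (m : Fin k) :
    ((ω m).left, true) ≠ (w, decide ((ω i).letter w = 0)) := by
  intro he
  simp only [Prod.mk.injEq, eq_comm (a := true), decide_eq_true_eq] at he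
  have h₁ := h.left_lt
  rcases Arc.eq_left_or_right_of_letter_eq_zero he.2 h₁.le h.le_right_lower with hw | hw
  · omega
  · exact left_ne_right hω m i (he.1.trans hw)

theorem IsClockwiseOrdered.isSlot_unique {ω : Fin k → Arc n} (h : IsClockwiseOrdered ω)
    {i i' : Fin k} {p : ℕ × Bool} (hi : IsSlot ω i p) (hi' : IsSlot ω i' p) : i = i' := by
  rcases hi with ⟨rfl, hi⟩ | ⟨j, w, hw, rfl⟩ <;> rcases hi' with ⟨hp, hi'⟩ | ⟨j', w', hw', hp⟩
  · have hl : (ω i).left = (ω i').left := congrArg Prod.fst hp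
    rcases lt_trichotomy i i' with hlt | he | hlt
    · exact absurd ⟨i, hlt, hl⟩ hi'
    · exact he
    · exact absurd ⟨i', hlt, hl.symm⟩ hi
  · exact absurd hp (hw'.slot_ne h.noncrossing i)
  · exact absurd hp.symm (hw.slot_ne h.noncrossing i')
  · simp only [Prod.mk.injEq, decide_eq_decide] at hp
    obtain ⟨rfl, hp⟩ := hp
    refine hw.lower_unique h.noncrossing hw' ?_
    have h₁ := hw.letter_lower
    have h₂ := hw'.letter_lower
    revert hp h₁ h₂
    generalize (ω i).letter w = s
    generalize (ω i').letter w = t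
    revert s t
    decide

/-- Let `ε` be a side, and read `B a b` as "`b` lies on the side `ε` of `a`". If over every
inner node some arc passes on that side, then an arc from the node `0` with no other arc from `0` on
that side of it ends at the node `n`: no arc at all lies on that side of it, because the left
endpoint of the one that starts leftmost would be passed by yet another. -/
theorem right_eq_of_extremal {ω : Fin k → Arc n} (hω : ∀ i j, i ≠ j → (ω i).Noncrossing (ω j))
    {B : Arc n → Arc n → Prop} {ε : SignType} (hε : ε ≠ 0)
    (hB : ∀ a b : Arc n, a.Noncrossing b → ∀ v, a.left ≤ v → b.left ≤ v → v ≤ a.right →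
      v ≤ b.right → a.letter v ≠ ε → b.letter v = ε → B a b)
    (hB' : ∀ a b : Arc n, B a b → b.left < a.right ∧ (a.left ≤ b.left → a.letter b.left ≠ ε))
    (hpass : ∀ w, 0 < w → w < n → ∃ i, (ω i).letter w = ε)
    {t : Fin k} (ht : (ω t).left = 0) (htop : ∀ c, (ω c).left = 0 → c ≠ t → ¬ B (ω t) (ω c)) :
    (ω t).right = n := by
  have ht' := (ω t).left_lt_right
  have htn := (ω t).right_le
  have next : ∀ v, 0 < v → v < n → v ≤ (ω t).right → (ω t).letter v ≠ ε →
      ∃ c, c ≠ t ∧ (ω c).left < v ∧ B (ω t) (ω c) := by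
    intro v hv hvn hvt hne
    obtain ⟨c, hc⟩ := hpass v hv hvn
    have hct : c ≠ t := by rintro rfl; exact hne hc
    obtain ⟨h₁, h₂⟩ := ((ω c).letter_ne_zero_iff v).1 (hc ▸ hε)
    exact ⟨c, hct, h₁, hB _ _ (hω t c hct.symm) v (by omega) h₁.le hvt h₂.le hne hc⟩
  have none : ∀ v c, (ω c).left = v → c ≠ t → ¬ B (ω t) (ω c) := by
    intro v
    induction v using Nat.strong_induction_on with
    | _ v ih =>
      rintro c rfl hct hb
      obtain ⟨h₁, h₂⟩ := hB' _ _ hb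
      rcases Nat.eq_zero_or_pos (ω c).left with h0 | h0
      · exact htop c h0 hct hb
      · obtain ⟨c', hc', hlt, hb'⟩ := next _ h0 (by omega) h₁.le (h₂ (by omega))
        exact ih _ hlt c' rfl hc' hb'
  by_contra hr
  obtain ⟨c, hct, -, hb⟩ := next (ω t).right (by omega) (by omega) le_rfl
    (by rw [(ω t).letter_right]; exact hε.symm)
  exact none _ c rfl hct hb

/-- Some inner node is on the upper or on the lower boundary of the diagram. -/
theorem IsClockwiseOrdered.exists_exposed {ω : Fin k → Arc n} (h : IsClockwiseOrdered ω)
    (hn : 2 ≤ n) : ∃ w, 0 < w ∧ w < n ∧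
      ((∀ i, (ω i).letter w ≠ 1) ∨ ∀ i, (ω i).letter w ≠ -1) := by
  classical
  by_contra! hcon
  have hω := h.noncrossing
  obtain ⟨⟨a, ha⟩, ⟨b, hb⟩⟩ := hcon 1 one_pos (by omega)
  have ha0 : (ω a).left = 0 := by
    have := (((ω a).letter_ne_zero_iff 1).1 (by rw [ha]; decide)).1
    omega
  have hb0 : (ω b).left = 0 := by
    have := (((ω b).letter_ne_zero_iff 1).1 (by rw [hb]; decide)).1
    omega
  have hne : (Finset.univ.filter fun c => (ω c).left = 0).Nonempty := ⟨a, by simpa using ha0⟩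
  obtain ⟨t, ht, htmin⟩ := Finset.exists_min_image _ id hne
  obtain ⟨s, hs, hsmax⟩ := Finset.exists_max_image _ id hne
  simp only [Finset.mem_filter, Finset.mem_univ, true_and, id_eq] at ht htmin hs hsmax
  have htr : (ω t).right = n := by
    refine right_eq_of_extremal (B := Arc.IsBelow) (ε := 1) hω (by decide)
      (fun a b hab v h₁ h₂ h₃ h₄ hav hbv => hab.isBelow_of_letter_lt h₁ h₂ h₃ h₄ ?_)
      (fun a b hab => ⟨hab.2.1, fun hl he => ?_⟩) (fun w h₁ h₂ => (hcon w h₁ h₂).1) ht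
      fun c hc hct => ?_
    · rw [hbv]
      exact lt_of_le_of_ne (SignType.le_one _) hav
    · have := hab.2.2 b.left hl le_rfl hab.2.1.le b.left_lt_right.le
      rw [he, b.letter_left] at this
      exact absurd this (by decide)
    · exact (hω c t hct).not_isBelow
        (h.isBelow (lt_of_le_of_ne (htmin c hc) hct.symm) (ht.trans hc.symm))
  have hsr : (ω s).right = n := by
    refine right_eq_of_extremal (B := fun a b => b.IsBelow a) (ε := -1) hω (by decide)
      (fun a b hab v h₁ h₂ h₃ h₄ hav hbv => hab.symm.isBelow_of_letter_lt h₂ h₁ h₄ h₃ ?_)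
      (fun a b hab => ⟨hab.1, fun hl he => ?_⟩) (fun w h₁ h₂ => (hcon w h₁ h₂).2) hs
      fun c hc hct => ?_
    · rw [hbv]
      exact lt_of_le_of_ne (SignType.neg_one_le _) hav.symm
    · have := hab.2.2 b.left le_rfl hl b.left_lt_right.le hab.1.le
      rw [he, b.letter_left] at this
      exact absurd this (by decide)
    · exact (hω s c hct.symm).not_isBelow
        (h.isBelow (lt_of_le_of_ne (hsmax c hc) hct) (hc.trans hs.symm))
  have hts : t = s := by
    by_contra hne
    exact (hω t s hne).endpoints_ne ⟨ht.trans hs.symm, htr.trans hsr.symm⟩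
  have hat : a = t := le_antisymm (hts ▸ hsmax a ha0) (htmin a ha0)
  have hbt : b = t := le_antisymm (hts ▸ hsmax b hb0) (htmin b hb0)
  rw [hat] at ha
  rw [hbt, ha] at hb
  exact absurd hb (by decide)

/-- At an exposed inner node one of the two slots is free. -/
theorem exists_not_isSlot {ω : Fin k → Arc n} (hω : ∀ i j, i ≠ j → (ω i).Noncrossing (ω j))
    {v : ℕ} (hv : (∀ i, (ω i).letter v ≠ 1) ∨ ∀ i, (ω i).letter v ≠ -1) :
    ∃ b, ∀ i, ¬ IsSlot ω i (v, b) := by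
  by_cases hlow : ∀ i, (ω i).letter v ≠ -1
  · refine ⟨false, fun i hi => ?_⟩
    rcases hi with ⟨hp, -⟩ | ⟨j, w, hw, hp⟩
    · simp at hp
    · simp only [Prod.mk.injEq, eq_comm (a := false), decide_eq_false_iff_not] at hp
      obtain ⟨rfl, hp⟩ := hp
      have h₁ := hw.letter_lower
      have h₂ := hlow i
      revert hp h₁ h₂
      generalize (ω i).letter v = s
      revert s
      decide
  have hup := hv.resolve_right hlow
  have hzero : ∀ {i j}, IsWedge ω i j v → (ω j).letter v = 0 := fun {i j} hw => by
    have h₁ := hw.letter_upper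
    have h₂ := hup j
    revert h₁ h₂
    generalize (ω j).letter v = s
    revert s
    decide
  by_cases hleft : ∃ m, (ω m).left = v
  · -- a wedge with first node `v` has an upper arc that ends there
    refine ⟨false, fun i hi => ?_⟩
    rcases hi with ⟨hp, -⟩ | ⟨j, w, hw, hp⟩
    · simp at hp
    · simp only [Prod.mk.injEq] at hp
      obtain ⟨rfl, -⟩ := hp
      obtain ⟨m, hm⟩ := hleft
      have h₁ := hw.left_lt
      have h₂ := hw.left_eq
      rcases Arc.eq_left_or_right_of_letter_eq_zero (hzero hw) (by omega) hw.le_right_upper with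
        h₃ | h₃
      · omega
      · exact left_ne_right hω m j (hm.trans h₃)
  · refine ⟨true, fun i hi => ?_⟩
    rcases hi with ⟨hp, -⟩ | ⟨j, w, hw, hp⟩
    · exact hleft ⟨i, (congrArg Prod.fst hp).symm⟩
    · simp only [Prod.mk.injEq, eq_comm (a := true), decide_eq_true_eq] at hp
      obtain ⟨rfl, hp⟩ := hp
      have := hw.letter_lt hω
      rw [hp, hzero hw] at this
      exact lt_irrefl _ this

/-- There are `2 * (n + 1)` slots, of which the node `0` has one free, the node `n` two, and an
exposed inner node one. -/
theorem IsClockwiseOrdered.length_le {ω : Fin k → Arc n} (h : IsClockwiseOrdered ω)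
    (hn : 2 ≤ n) : k ≤ 2 * n - 2 := by
  classical
  obtain ⟨v, hv0, hvn, hv⟩ := h.exists_exposed hn
  obtain ⟨b, hb⟩ := exists_not_isSlot h.noncrossing hv
  choose slot hslot using h.exists_isSlot
  let free : Finset (ℕ × Bool) := {(0, false), (n, false), (n, true), (v, b)}
  let all : Finset (ℕ × Bool) := Finset.range (n + 1) ×ˢ Finset.univ
  have hfree : free.card = 4 := by
    have h₁ : (n, true) ∉ ({(v, b)} : Finset (ℕ × Bool)) := by simp; omega
    have h₂ : (n, false) ∉ ({(n, true), (v, b)} : Finset (ℕ × Bool)) := by simp; omega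
    have h₃ : (0, false) ∉ ({(n, false), (n, true), (v, b)} : Finset (ℕ × Bool)) := by
      simp; omega
    simp only [free]
    rw [Finset.card_insert_of_notMem h₃, Finset.card_insert_of_notMem h₂,
      Finset.card_insert_of_notMem h₁, Finset.card_singleton]
  have hsub : free ⊆ all := by
    intro p hp
    simp only [free, Finset.mem_insert, Finset.mem_singleton] at hp
    simp only [all, Finset.mem_product, Finset.mem_range, Finset.mem_univ, and_true]
    rcases hp with rfl | rfl | rfl | rfl <;> dsimp only <;> omega
  have hmaps : ∀ i ∈ (Finset.univ : Finset (Fin k)), slot i ∈ all \ free := by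
    intro i _
    have hi := hslot i
    have hb' := hb i
    have hlr := (ω i).left_lt_right
    have hrn := (ω i).right_le
    generalize slot i = p at hi
    simp only [Finset.mem_sdiff, all, free, Finset.mem_product, Finset.mem_range,
      Finset.mem_univ, and_true, Finset.mem_insert, Finset.mem_singleton, not_or]
    refine ⟨?_, ?_, ?_, ?_, fun hp => hb' (hp ▸ hi)⟩
    · rcases hi with ⟨rfl, -⟩ | ⟨j, w, hw, rfl⟩
      · dsimp only
        omega
      · have := hw.le_right_lower
        dsimp only
        omega
    · rintro rfl
      rcases hi with ⟨hp, -⟩ | ⟨j, w, hw, hp⟩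
      · simp at hp
      · have := hw.left_lt
        simp only [Prod.mk.injEq] at hp
        omega
    · rintro rfl
      rcases hi with ⟨hp, -⟩ | ⟨j, w, hw, hp⟩
      · simp at hp
      · simp only [Prod.mk.injEq, eq_comm (a := false), decide_eq_false_iff_not] at hp
        have := ((ω i).letter_ne_zero_iff w).1 hp.2
        omega
    · rintro rfl
      rcases hi with ⟨hp, -⟩ | ⟨j, w, hw, hp⟩
      · simp only [Prod.mk.injEq] at hp
        omega
      · simp only [Prod.mk.injEq, eq_comm (a := true), decide_eq_true_eq] at hp
        have hlt := hw.letter_lt h.noncrossing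
        rw [hp.2] at hlt
        have := ((ω j).letter_ne_zero_iff w).1 hlt.ne'
        have := (ω j).right_le
        omega
  have hcard := Finset.card_le_card_of_injOn slot hmaps fun i _ j _ hij =>
    h.isSlot_unique (hslot i) (hij ▸ hslot j)
  rw [Finset.card_sdiff_of_subset hsub, hfree] at hcard
  simp only [all, Finset.card_univ, Fintype.card_fin, Finset.card_product, Finset.card_range,
    Fintype.card_bool] at hcard
  omega

/-! ### A diagram of maximal length -/

/-- The parabola `c * (x - l) * (r - x)` as a curve from `l` to `r`. -/
noncomputable def parabola {l r : ℕ} (hlr : l < r) (hr : r ≤ n) {c : ℝ} (hc : c ≠ 0) :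
    Curve n where
  left := l
  right := r
  left_lt_right := hlr
  right_le := hr
  toFun x := c * ((x - l) * (r - x))
  continuousOn := by fun_prop
  map_left := by simp
  map_right := by simp
  map_ne_zero k h₁ h₂ := by
    have h₁' : (l : ℝ) < k := by exact_mod_cast h₁
    have h₂' : (k : ℝ) < r := by exact_mod_cast h₂
    exact mul_ne_zero hc (mul_ne_zero (by linarith) (by linarith))

theorem parabola_meetAtMostOnce {l r r' : ℕ} (hlr : l < r) (hr : r ≤ n) (hlr' : l < r')
    (hr' : r' ≤ n) {c : ℝ} (hc : c ≠ 0) (hne : r ≠ r') :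
    (parabola hlr hr hc).MeetAtMostOnce (parabola hlr' hr' hc) := by
  refine ⟨fun h => hne h.2, fun x _ _ hx => .inl ?_⟩
  change c * ((x - l) * (r - x)) = c * ((x - l) * (r' - x)) at hx
  change x = l ∧ x = l
  have hne' : (r : ℝ) - r' ≠ 0 := sub_ne_zero.2 (by exact_mod_cast hne)
  have : (x - l) * ((r : ℝ) - r') = 0 := by linear_combination mul_left_cancel₀ hc hx
  have := sub_eq_zero.1 ((mul_eq_zero.1 this).resolve_right hne')
  exact ⟨this, this⟩

theorem parabola_meetAtMostOnce_of_opposite {r r' : ℕ} (h : 1 < r) (hr : r ≤ n) (h' : 1 < r')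
    (hr' : r' ≤ n) :
    (parabola h hr (neg_ne_zero.2 one_ne_zero)).MeetAtMostOnce
      (parabola (zero_lt_one.trans h') hr' one_ne_zero) := by
  refine ⟨fun h => one_ne_zero h.1, fun x hx₁ hx₂ hx => .inr ?_⟩
  change x ∈ Set.Icc ((1 : ℕ) : ℝ) r at hx₁
  change x ∈ Set.Icc ((0 : ℕ) : ℝ) r' at hx₂
  change -1 * ((x - (1 : ℕ)) * (r - x)) = 1 * ((x - (0 : ℕ)) * (r' - x)) at hx
  change x = r ∧ x = r'
  push_cast at hx hx₁ hx₂
  have h₁ : 0 ≤ (x - 1) * (r - x) := mul_nonneg (by linarith [hx₁.1]) (by linarith [hx₁.2])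
  have h₂ : 0 ≤ x * (r' - x) := mul_nonneg hx₂.1 (by linarith [hx₂.2])
  have h₃ : x = r' := by
    have : x * (r' - x) = 0 := by linarith
    have := (mul_eq_zero.1 this).resolve_left (by linarith [hx₁.1])
    linarith
  refine ⟨?_, h₃⟩
  have h₄ : (1 : ℝ) < r' := by exact_mod_cast h'
  have : (x - 1) * (r - x) = 0 := by linarith
  have := (mul_eq_zero.1 this).resolve_left (by linarith)
  linarith

/-- The diagram of `K_{n-1,2}`: arcs from the node `1` below all nodes, in increasing length, then
arcs from the node `0` above all nodes, in decreasing length. -/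
noncomputable def fanCurve (n : ℕ) (i : Fin (2 * n - 2)) : Curve n :=
  if h : (i : ℕ) < n - 1 then
    parabola (l := 1) (r := i + 2) (by omega) (by omega) (c := -1) (neg_ne_zero.2 one_ne_zero)
  else
    parabola (l := 0) (r := 2 * n - 1 - i) (by omega) (by omega) (c := 1) one_ne_zero

theorem fanCurve_of_lt {i : Fin (2 * n - 2)} (h : (i : ℕ) < n - 1) :
    fanCurve n i = parabola (l := 1) (r := i + 2) (by omega) (by omega) (c := -1)
      (neg_ne_zero.2 one_ne_zero) := dif_pos h

theorem fanCurve_of_le {i : Fin (2 * n - 2)} (h : n - 1 ≤ (i : ℕ)) :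
    fanCurve n i = parabola (l := 0) (r := 2 * n - 1 - i) (by omega) (by omega) (c := 1)
      one_ne_zero := dif_neg (not_lt.2 h)

/-- The arcs of the curves `fanCurve`. -/
noncomputable def fan (n : ℕ) (i : Fin (2 * n - 2)) : Arc n :=
  Quotient.mk (Curve.setoid n) (fanCurve n i)

theorem left_fan (i : Fin (2 * n - 2)) : (fan n i).left = if (i : ℕ) < n - 1 then 1 else 0 := by
  change (fanCurve n i).left = _
  split_ifs with h
  · rw [fanCurve_of_lt h]; rfl
  · rw [fanCurve_of_le (not_lt.1 h)]; rfl

theorem right_fan (i : Fin (2 * n - 2)) :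
    (fan n i).right = if (i : ℕ) < n - 1 then (i : ℕ) + 2 else 2 * n - 1 - i := by
  change (fanCurve n i).right = _
  split_ifs with h
  · rw [fanCurve_of_lt h]; rfl
  · rw [fanCurve_of_le (not_lt.1 h)]; rfl

theorem parabola_passesAbove {l r k : ℕ} (hlr : l < r) (hr : r ≤ n) (h₁ : l < k) (h₂ : k < r) :
    (parabola hlr hr (one_ne_zero (α := ℝ))).PassesAbove k := by
  refine ⟨h₁, h₂, sign_pos ?_⟩
  change (0 : ℝ) < 1 * (((k : ℝ) - l) * (r - k))
  rw [one_mul]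
  exact mul_pos (sub_pos.2 (by exact_mod_cast h₁)) (sub_pos.2 (by exact_mod_cast h₂))

theorem parabola_passesBelow {l r k : ℕ} (hlr : l < r) (hr : r ≤ n) (h₁ : l < k) (h₂ : k < r) :
    (parabola hlr hr (neg_ne_zero.2 (one_ne_zero (α := ℝ)))).PassesBelow k := by
  refine ⟨h₁, h₂, sign_neg ?_⟩
  change -1 * (((k : ℝ) - l) * (r - k)) < 0
  rw [neg_one_mul, neg_lt_zero]
  exact mul_pos (sub_pos.2 (by exact_mod_cast h₁)) (sub_pos.2 (by exact_mod_cast h₂))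

theorem isClockwiseOrdered_fan (n : ℕ) : IsClockwiseOrdered (fan n) where
  meetAtMostOnce i j hij := by
    have hij' : (i : ℕ) < j := hij
    refine ⟨fanCurve n i, fanCurve n j, rfl, rfl, ?_⟩
    rcases lt_or_ge (j : ℕ) (n - 1) with hj | hj
    · rw [fanCurve_of_lt hj, fanCurve_of_lt (hij'.trans hj)]
      exact parabola_meetAtMostOnce _ _ _ _ _ (by omega)
    rcases lt_or_ge (i : ℕ) (n - 1) with hi | hi
    · rw [fanCurve_of_lt hi, fanCurve_of_le hj]
      exact parabola_meetAtMostOnce_of_opposite _ _ (by omega) _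
    · rw [fanCurve_of_le hi, fanCurve_of_le hj]
      exact parabola_meetAtMostOnce _ _ _ _ _ (by omega)
  clockwise i j hij hs := by
    have hij' : (i : ℕ) < j := hij
    unfold Arc.IsClockwiseOf
    have habove : ∀ (i : Fin (2 * n - 2)) (v : ℕ), n - 1 ≤ (i : ℕ) → 0 < v → v < 2 * n - 1 - i →
        (fan n i).PassesAbove v := fun i v hi h₁ h₂ => by
      change (fanCurve n i).PassesAbove v
      rw [fanCurve_of_le hi]
      exact parabola_passesAbove _ _ h₁ h₂
    rw [left_fan, left_fan, right_fan, right_fan] at hs ⊢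
    rcases lt_or_ge (j : ℕ) (n - 1) with hj | hj
    · have hi := hij'.trans hj
      simp only [if_pos hi, if_pos hj]
      refine .inl ⟨trivial, .inl ⟨by omega, ?_⟩⟩
      change (fanCurve n j).PassesBelow _
      rw [fanCurve_of_lt hj]
      exact parabola_passesBelow _ _ (by omega) (by omega)
    rcases lt_or_ge (i : ℕ) (n - 1) with hi | hi
    · simp only [if_pos hi, if_neg (not_lt.2 hj)] at hs ⊢
      exact .inr ⟨by omega, .inr ⟨one_pos, habove j 1 hj one_pos (by omega)⟩⟩
    · simp only [if_neg (not_lt.2 hi), if_neg (not_lt.2 hj)]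
      exact .inl ⟨trivial, .inr ⟨by omega, habove i _ hi (by omega) (by omega)⟩⟩

theorem graph_fan_adj (p q : Fin (n + 1)) :
    (graph (fan n)).Adj p q ↔ ((p : ℕ) < 2 ∧ 2 ≤ (q : ℕ)) ∨ ((q : ℕ) < 2 ∧ 2 ≤ (p : ℕ)) := by
  have key : ∀ p q : Fin (n + 1), (∃ i, (fan n i).left = p ∧ (fan n i).right = q) ↔
      (p : ℕ) < 2 ∧ 2 ≤ (q : ℕ) := by
    intro p q
    simp only [left_fan, right_fan]
    constructor
    · rintro ⟨i, h₁, h₂⟩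
      split_ifs at h₁ h₂ <;> omega
    · rintro ⟨h₁, h₂⟩
      rcases Nat.eq_zero_or_pos (p : ℕ) with hp | hp
      · refine ⟨⟨2 * n - 1 - q, by omega⟩, ?_⟩
        rw [if_neg (by simp only; omega), if_neg (by simp only; omega)]
        simp only
        omega
      · refine ⟨⟨q - 2, by omega⟩, ?_⟩
        rw [if_pos (by simp only; omega), if_pos (by simp only; omega)]
        simp only
        omega
  change (∃ i, _ ∨ _) ↔ _
  rw [exists_or, key, key]

theorem nonempty_graph_fan_iso (hn : 2 ≤ n) :
    Nonempty (graph (fan n) ≃g completeBipartiteGraph (Fin (n - 1)) (Fin 2)) := by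
  let e : Fin (n - 1) ⊕ Fin 2 ≃ Fin (n + 1) :=
    (Equiv.sumComm _ _).trans (finSumFinEquiv.trans (finCongr (by omega)))
  have hl : ∀ a, ((e (.inl a) : Fin (n + 1)) : ℕ) = 2 + a := fun a => by simp [e]
  have hr : ∀ b, ((e (.inr b) : Fin (n + 1)) : ℕ) = b := fun b => by simp [e]
  refine ⟨(RelIso.mk e fun {x y} => ?_ :
    completeBipartiteGraph (Fin (n - 1)) (Fin 2) ≃g graph (fan n)).symm⟩
  rw [graph_fan_adj]
  rcases x with x | x <;> rcases y with y | y <;>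
    simp [hl, hr, completeBipartiteGraph] <;> omega

end ArcDiagram

open ArcDiagram in
theorem corollary6p6 (n : ℕ) (hn : 1 ≤ n) :
    (∀ (k : ℕ) (ω : Fin k → ArcDiagram.Arc n), ArcDiagram.IsClockwiseOrdered ω →
      (∃ γ : Fin k → ArcDiagram.Curve n,
        (∀ i, ArcDiagram.Arc.IsRep (γ i) (ω i)) ∧
        (∀ i j, i ≠ j → (γ i).MeetAtMostOnce (γ j))) ∧
      (ArcDiagram.graph ω).edgeSet.ncard = k ∧
      (ArcDiagram.graph ω).IsBipartite ∧
      ArcDiagram.IsPlanar (ArcDiagram.graph ω)) ∧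
    IsGreatest {k : ℕ | ∃ ω : Fin k → ArcDiagram.Arc n, ArcDiagram.IsClockwiseOrdered ω}
      (max 1 (2 * n - 2)) ∧
    (2 ≤ n → ∃ ω : Fin (2 * n - 2) → ArcDiagram.Arc n, ArcDiagram.IsClockwiseOrdered ω ∧
      Nonempty (ArcDiagram.graph ω ≃g completeBipartiteGraph (Fin (n - 1)) (Fin 2))) := by
  refine ⟨fun k ω h => ⟨⟨stackedCurve ω, isRep_stackedCurve ω, fun i j hij =>
      stackedCurve_meetAtMostOnce h.noncrossing hij⟩, ncard_edgeSet_graph h.noncrossing,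
      isBipartite_graph h.noncrossing, isPlanar_graph (isRep_stackedCurve ω) fun i j hij =>
      stackedCurve_meetAtMostOnce h.noncrossing hij⟩, ?_,
    fun h => ⟨fan n, isClockwiseOrdered_fan n, nonempty_graph_fan_iso h⟩⟩
  obtain rfl | hn' := hn.eq_or_lt
  · refine ⟨⟨fun _ => Quotient.mk _ (parabola zero_lt_one le_rfl one_ne_zero),
      fun i j hij => absurd hij (by omega), fun i j hij => absurd hij (by omega)⟩, ?_⟩
    rintro k ⟨ω, h⟩
    by_contra hk
    have hk' : 1 < k := by simpa using hk
    -- on two nodes all arcs have the same endpoints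
    refine (h.noncrossing ⟨0, by omega⟩ ⟨1, hk'⟩ (by simp)).endpoints_ne ?_
    have h₁ := (ω ⟨0, by omega⟩).left_lt_right
    have h₂ := (ω ⟨0, by omega⟩).right_le
    have h₃ := (ω ⟨1, hk'⟩).left_lt_right
    have h₄ := (ω ⟨1, hk'⟩).right_le
    omega
  · rw [max_eq_right (by omega)]
    exact ⟨⟨fan n, isClockwiseOrdered_fan n⟩, fun k ⟨ω, h⟩ => h.length_le hn'⟩
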